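/- A finite abstract simplicial complex $G$ is a finite set of non-empty finite sets closed under taking non-empty subsets. Let $\Gamma$ be the graph with vertex set $G$ in which two different sets are adjacent if one contains the other, and for $x\in G$ let the unit sphere $S(x)$ be the subgraph of $\Gamma$ induced on the neighbours of $x$; unit spheres in any finite simple graph are defined in the same way. Contractible graphs are defined inductively: the one-point graph is contractible, and a finite simple graph $A$ is contractible if it has a vertex $x$ such that $S(x)$ and $A-x$ are both contractible. The $(-1)$-sphere is the empty graph; for $d\ge 0$, a $d$-sphere is a finite simple graph all of whose unit spheres are $(d-1)$-spheres and which has a vertex $x$ such that removing $x$ leaves a contractible graph. There are no $(-1)$-balls; for $d\ge 0$, a $d$-ball is a contractible finite simple graph in which every unit sphere is a $(d-1)$-sphere or a $(d-1)$-ball, and in which the subgraph induced on the vertices whose unit sphere is a $(d-1)$-ball is a $(d-1)$-sphere. For $d\ge 0$, a $d$-complex with boundary (a discrete $d$-manifold with boundary) is a finite abstract simplicial complex $G$ such that for every $x\in G$ the graph $S(x)$ is a $(d-1)$-sphere or a $(d-1)$-ball. Its boundary $\delta G$ is the set of all $x\in G$ for which $S(x)$ is a $(d-1)$-ball. For a non-empty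 finite set $x$ let $\omega(x)=(-1)^{|x|-1}$, and let $$\chi(G)=\sum_{x\in G}\omega(x),\qquad \omega(G)=\sum_{\substack{(x,y)\in G\times G\\ x\cap y\ne\emptyset}}\omega(x)\,\omega(y)$$ be the Euler characteristic and the Wu characteristic. **Theorem.** Let $d\ge 0$ and let $G$ be a $d$-complex with boundary. Then $\delta G$ is a simplicial complex and $$\omega(G)=\chi(G)-\chi(\delta G).$$ Equivalently, the internal energy $E(G)=\chi(G)-\omega(G)$ satisfies $E(G)=\chi(\delta G)$. -/

import Mathlib

namespace DiscreteManifold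

section Graphs

variable {V : Type*}

/-! Throughout, a finite set `A` of vertices of an ambient graph `Γ` stands for the finite simple
graph that `Γ` induces on `A`. -/

open scoped Classical in
/-- The unit sphere `S(x)` in the graph induced on `A`: the neighbours of `x` in `A`. -/
noncomputable def unitSphere (Γ : SimpleGraph V) (A : Finset V) (x : V) : Finset V :=
  A.filter fun y => Γ.Adj x y

open scoped Classical in
/-- Contractible graphs: the one-point graph is contractible, and a graph is contractible if it
has a vertex `x` such that both `S(x)` and the graph with `x` removed are contractible. -/
inductive IsContractible (Γ : SimpleGraph V) : Finset V → Prop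
  | point (x : V) : IsContractible Γ {x}
  | step (A : Finset V) (x : V) (hx : x ∈ A) (hS : IsContractible Γ (unitSphere Γ A x))
      (hA : IsContractible Γ (A.erase x)) : IsContractible Γ A

open scoped Classical in
/-- `IsSphere Γ n A` says that the graph induced on `A` is an `(n - 1)`-sphere (the index is
shifted by one, since dimensions of spheres start at `-1`). The `(-1)`-sphere is the empty graph.
A `d`-sphere is a graph all of whose unit spheres are `(d - 1)`-spheres and which becomes
contractible after the removal of some vertex. -/
def IsSphere (Γ : SimpleGraph V) : ℕ → Finset V → Prop
  | 0, A => A = ∅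
  | n + 1, A => (∀ x ∈ A, IsSphere Γ n (unitSphere Γ A x)) ∧
      ∃ x ∈ A, IsContractible Γ (A.erase x)

open scoped Classical in
/-- `IsBall Γ n A` says that the graph induced on `A` is an `(n - 1)`-ball (the same shift as in
`IsSphere`). There is no `(-1)`-ball. A `d`-ball is a contractible graph in which every unit sphere
is a `(d - 1)`-sphere or a `(d - 1)`-ball, and whose boundary, the graph induced on the vertices
for which the unit sphere is a `(d - 1)`-ball, is a `(d - 1)`-sphere. -/
def IsBall (Γ : SimpleGraph V) : ℕ → Finset V → Prop
  | 0, _ => False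
  | n + 1, A => IsContractible Γ A ∧
      (∀ x ∈ A, IsSphere Γ n (unitSphere Γ A x) ∨ IsBall Γ n (unitSphere Γ A x)) ∧
      IsSphere Γ n (A.filter fun x => IsBall Γ n (unitSphere Γ A x))

end Graphs

section Complexes

variable {ι : Type*}

/-- A finite abstract simplicial complex: a finite set of non-empty finite sets that is closed
under taking non-empty subsets. -/
def IsComplex (G : Finset (Finset ι)) : Prop :=
  ∃ K : PreAbstractSimplicialComplex ι, K.faces = (G : Set (Finset ι))

/-- Two different sets are adjacent if one is contained in the other. The graph induced on a
complex `G` is the graph whose Whitney complex is the Barycentric refinement of `G`. -/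
def inclusionGraph (ι : Type*) : SimpleGraph (Finset ι) where
  Adj x y := x ⊂ y ∨ y ⊂ x
  symm := ⟨fun _ _ h => h.symm⟩
  loopless := ⟨fun x h => h.elim (ssubset_irrefl x) (ssubset_irrefl x)⟩

/-- A complex with boundary of dimension `d` (discrete `d`-manifold with boundary): every unit
sphere `S(x)`, `x ∈ G`, is a `(d - 1)`-sphere or a `(d - 1)`-ball. -/
def IsComplexWithBoundary (d : ℕ) (G : Finset (Finset ι)) : Prop :=
  IsComplex G ∧ ∀ x ∈ G,
    IsSphere (inclusionGraph ι) d (unitSphere (inclusionGraph ι) G x) ∨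
    IsBall (inclusionGraph ι) d (unitSphere (inclusionGraph ι) G x)

open scoped Classical in
/-- The boundary `δG` of a `d`-complex with boundary: the sets `x ∈ G` for which `S(x)` is a
`(d - 1)`-ball. -/
noncomputable def boundary (d : ℕ) (G : Finset (Finset ι)) : Finset (Finset ι) :=
  G.filter fun x => IsBall (inclusionGraph ι) d (unitSphere (inclusionGraph ι) G x)

/-- `ω(x) = (-1) ^ dim x` with `dim x = |x| - 1` (`x` is non-empty). -/
def sign (x : Finset ι) : ℤ := (-1) ^ (x.card - 1)

/-- The Euler characteristic `χ(G)`. -/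
def eulerChar (G : Finset (Finset ι)) : ℤ := ∑ x ∈ G, sign x

open scoped Classical in
/-- The Wu characteristic: the sum of `ω(x) ω(y)` over all ordered pairs of intersecting sets
`x, y ∈ G` (including `x = y`). -/
noncomputable def wuChar (G : Finset (Finset ι)) : ℤ :=
  ∑ x ∈ G, ∑ y ∈ G with (x ∩ y).Nonempty, sign x * sign y

/-- The internal energy `E(G) = χ(G) - ω(G)`. -/
noncomputable def internalEnergy (G : Finset (Finset ι)) : ℤ := eulerChar G - wuChar G

end Complexes

end DiscreteManifold

/-! Two simplices meet exactly when the signs of their common faces sum to 1 instead of 0. Hence the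
Wu characteristic is the sum over `z` of `sign z` times the square of the signed count of the star
of `z` (`wuChar_eq_sum_star`). Up to sign that count is the clique sum (one minus the Euler
characteristic) of the upper link of `z` (`sum_star_sign`). The unit sphere of `z` is the join of
the proper faces of `z`, with clique sum 1 or -1, and the upper link. Clique sums are multiplicative
under joins (`cliqueSum_union`), 1 or -1 on spheres and 0 on balls. So the square is 1 off the
boundary and 0 on it, leaving the sum of the signs of the interior simplices. -/

namespace DiscreteManifold

/-! ### Clique sums of joins, spheres and balls -/

section Graphs

variable {V : Type*}

open scoped Classical in
/-- The sum of `(-1) ^ |c|` over all cliques `c` in `A`, the empty one included: one minus the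
Euler characteristic of the Whitney complex of the graph induced on `A`. -/
noncomputable def cliqueSum (Γ : SimpleGraph V) (A : Finset V) : ℤ :=
  ∑ c ∈ A.powerset, if Γ.IsClique (c : Set V) then (-1) ^ c.card else 0

theorem cliqueSum_empty (Γ : SimpleGraph V) : cliqueSum Γ ∅ = 1 := by
  simp [cliqueSum]

theorem mem_unitSphere {Γ : SimpleGraph V} {A : Finset V} {x y : V} :
    y ∈ unitSphere Γ A x ↔ y ∈ A ∧ Γ.Adj x y := by
  simp [unitSphere]

/-- Cliques through `x` are cliques of the unit sphere with `x` added, which flips their sign. -/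
theorem cliqueSum_eq_erase_sub [DecidableEq V] (Γ : SimpleGraph V) {A : Finset V} {x : V} (hx : x ∈ A) :
    cliqueSum Γ A = cliqueSum Γ (A.erase x) - cliqueSum Γ (unitSphere Γ A x) := by
  classical
  have hsub : (unitSphere Γ A x).powerset ⊆ (A.erase x).powerset := by
    refine Finset.powerset_mono.2 fun y hy => ?_
    rw [mem_unitSphere] at hy
    exact Finset.mem_erase.2 ⟨hy.2.ne', hy.1⟩
  have key : ∑ c ∈ (A.erase x).powerset,
      (if Γ.IsClique (↑(insert x c) : Set V) then (-1 : ℤ) ^ (insert x c).card else 0)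
      = - cliqueSum Γ (unitSphere Γ A x) := by
    rw [cliqueSum, ← Finset.sum_neg_distrib]
    symm
    refine Finset.sum_subset_zero_on_sdiff hsub ?_ ?_
    · intro c hc
      obtain ⟨hc, hc'⟩ := Finset.mem_sdiff.1 hc
      rw [Finset.mem_powerset] at hc hc'
      refine if_neg fun h => hc' fun y hy => mem_unitSphere.2 ⟨Finset.mem_of_mem_erase (hc hy), ?_⟩
      exact h (by simp) (by simp [hy]) (Finset.ne_of_mem_erase (hc hy)).symm
    · intro c hc
      have hxc : x ∉ c := fun h => Finset.notMem_erase x A (Finset.mem_powerset.1 (hsub hc) h)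
      have hiff : Γ.IsClique (↑(insert x c) : Set V) ↔ Γ.IsClique (c : Set V) := by
        rw [Finset.coe_insert, SimpleGraph.isClique_insert]
        exact and_iff_left fun b hb _ => (mem_unitSphere.1 (Finset.mem_powerset.1 hc hb)).2
      simp only [hiff, Finset.card_insert_of_notMem hxc, pow_succ]
      split_ifs <;> simp
  conv_lhs => rw [← Finset.insert_erase hx]
  rw [cliqueSum, Finset.sum_powerset_insert (Finset.notMem_erase x A), sub_eq_add_neg, ← key,
    cliqueSum]
  congr!

theorem cliqueSum_union [DecidableEq V] {Γ : SimpleGraph V} {A B : Finset V}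
    (h : ∀ a ∈ A, ∀ b ∈ B, Γ.Adj a b) :
    cliqueSum Γ (A ∪ B) = cliqueSum Γ A * cliqueSum Γ B := by
  induction A using Finset.strongInduction with
  | H A ih =>
    obtain rfl | ⟨x, hx⟩ := A.eq_empty_or_nonempty
    · simp [cliqueSum_empty]
    · have hxB : x ∉ B := fun hb => Γ.irrefl (h x hx x hb)
      have hsub : unitSphere Γ A x ⊆ A := fun y hy => (mem_unitSphere.1 hy).1
      have hS : unitSphere Γ (A ∪ B) x = unitSphere Γ A x ∪ B := by
        ext y
        simp only [mem_unitSphere, Finset.mem_union]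
        have := h x hx y
        tauto
      have hss : unitSphere Γ A x ⊂ A :=
        (Finset.ssubset_iff_of_subset hsub).2 ⟨x, hx, fun hh => Γ.irrefl (mem_unitSphere.1 hh).2⟩
      rw [cliqueSum_eq_erase_sub Γ (Finset.mem_union_left B hx), hS,
        Finset.erase_union_distrib, Finset.erase_eq_of_notMem hxB,
        ih _ (Finset.erase_ssubset hx) fun a ha => h a (Finset.mem_of_mem_erase ha),
        ih _ hss fun a ha => h a (hsub ha), cliqueSum_eq_erase_sub Γ hx]
      ring

theorem IsContractible.cliqueSum_eq_zero {Γ : SimpleGraph V} {A : Finset V}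
    (h : IsContractible Γ A) : cliqueSum Γ A = 0 := by
  classical
  induction h with
  | point x =>
    have hS : unitSphere Γ {x} x = ∅ := by
      ext y
      simp only [mem_unitSphere, Finset.mem_singleton, Finset.notMem_empty, iff_false]
      rintro ⟨rfl, h⟩
      exact Γ.irrefl h
    rw [cliqueSum_eq_erase_sub Γ (Finset.mem_singleton_self x), hS, Finset.erase_singleton,
      sub_self]
  | step A x hx _ _ h₁ h₂ =>
    rw [cliqueSum_eq_erase_sub Γ hx, h₁]
    convert h₂ using 1
    rw [sub_zero]

theorem IsSphere.cliqueSum_eq {Γ : SimpleGraph V} {n : ℕ} {A : Finset V}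
    (h : IsSphere Γ n A) : cliqueSum Γ A = (-1) ^ n := by
  induction n generalizing A with
  | zero =>
    obtain rfl : A = ∅ := h
    simp [cliqueSum_empty]
  | succ n ih =>
    classical
    obtain ⟨hS, x, hx, hc⟩ := h
    rw [cliqueSum_eq_erase_sub Γ hx, hc.cliqueSum_eq_zero, ih (hS x hx), pow_succ]
    ring

theorem IsBall.cliqueSum_eq_zero {Γ : SimpleGraph V} {n : ℕ} {A : Finset V}
    (h : IsBall Γ n A) : cliqueSum Γ A = 0 := by
  cases n with
  | zero => exact h.elim
  | succ n => exact h.1.cliqueSum_eq_zero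

/-- The obstruction that shows the boundary is closed under passing to faces. -/
theorem IsSphere.cliqueSum_unitSphere_ne_zero {Γ : SimpleGraph V} {n : ℕ} {A : Finset V} {x : V}
    (h : IsSphere Γ n A) (hx : x ∈ A) : cliqueSum Γ (unitSphere Γ A x) ≠ 0 := by
  cases n with
  | zero =>
    obtain rfl : A = ∅ := h
    simp at hx
  | succ n =>
    rw [(h.1 x hx).cliqueSum_eq]
    exact pow_ne_zero _ (by norm_num)

end Graphs

/-! ### Links and stars in a simplicial complex -/

section Complexes

variable {ι : Type*}

theorem isComplex_iff {G : Finset (Finset ι)} :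
    IsComplex G ↔ (∀ x ∈ G, x.Nonempty) ∧ ∀ x ∈ G, ∀ y ⊆ x, y.Nonempty → y ∈ G := by
  constructor
  · rintro ⟨K, hK⟩
    have hmem : ∀ x, x ∈ G ↔ x ∈ K.faces := fun x => by rw [hK, Finset.mem_coe]
    refine ⟨fun x hx => (K.isRelLowerSet_faces ((hmem x).1 hx)).1, fun x hx y hyx hy => ?_⟩
    exact (hmem y).2 ((K.isRelLowerSet_faces ((hmem x).1 hx)).2 hyx hy)
  · rintro ⟨h₁, h₂⟩
    exact ⟨⟨(G : Set (Finset ι)), fun x hx => ⟨h₁ x hx, fun y hyx hy => h₂ x hx y hyx hy⟩⟩, rfl⟩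

/-- Non-emptiness matters: the subtraction in `sign` truncates, so `sign ∅` is 1. -/
theorem sign_eq_neg {x : Finset ι} (h : x.Nonempty) : sign x = -(-1) ^ x.card := by
  obtain ⟨n, hn⟩ := Nat.exists_eq_succ_of_ne_zero h.card_pos.ne'
  simp [sign, hn, pow_succ]

open scoped Classical in
theorem sum_Ioo_neg_one_pow_card {z x : Finset ι} (h : z ⊂ x) :
    ∑ y ∈ Finset.Ioo z x, (-1 : ℤ) ^ y.card = -(-1) ^ z.card - (-1) ^ x.card := by
  -- The closed interval is a Boolean lattice of positive rank, so its signs cancel.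
  have hIcc : ∑ y ∈ Finset.Icc z x, (-1 : ℤ) ^ y.card = 0 := by
    have hne : (x \ z).Nonempty := Finset.sdiff_nonempty.2 h.2
    have hdisj : ∀ w ∈ (x \ z).powerset, Disjoint z w := fun w hw =>
      Finset.disjoint_of_subset_right (Finset.mem_powerset.1 hw) Finset.disjoint_sdiff
    rw [Finset.Icc_eq_image_powerset h.1, Finset.sum_image]
    · calc ∑ w ∈ (x \ z).powerset, (-1 : ℤ) ^ (z ∪ w).card
          = ∑ w ∈ (x \ z).powerset, (-1) ^ z.card * (-1 : ℤ) ^ w.card :=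
            Finset.sum_congr rfl fun w hw => by
              rw [Finset.card_union_of_disjoint (hdisj w hw), pow_add]
        _ = 0 := by
            rw [← Finset.mul_sum, Finset.sum_powerset_neg_one_pow_card_of_nonempty hne, mul_zero]
    · intro a ha b hb hab
      rw [← Finset.union_sdiff_cancel_left (hdisj a ha), show z ∪ a = z ∪ b from hab,
        Finset.union_sdiff_cancel_left (hdisj b hb)]
  rw [← Finset.Ico_insert_right h.1, Finset.sum_insert Finset.right_notMem_Ico,
    ← Finset.Ioo_insert_left h, Finset.sum_insert Finset.left_notMem_Ioo] at hIcc
  linarith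

open scoped Classical in
/-- The clique sum of a set of strict supersets of `z` that is closed downwards above `z`, such
as the face poset of a link, is an alternating sum over its elements. -/
theorem neg_one_pow_mul_cliqueSum {z : Finset ι} {A : Finset (Finset ι)}
    (hz : ∀ x ∈ A, z ⊂ x) (hA : ∀ x ∈ A, ∀ y, z ⊂ y → y ⊆ x → y ∈ A) :
    (-1) ^ z.card * cliqueSum (inclusionGraph ι) A
      = (-1) ^ z.card + ∑ x ∈ A, (-1 : ℤ) ^ x.card := by
  induction A using Finset.strongInduction with
  | H A ih =>
    obtain rfl | hne := A.eq_empty_or_nonempty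
    · simp [cliqueSum_empty]
    -- Removing an `x` of maximal size keeps the hypotheses, and its unit sphere is an open
    -- interval, also covered by induction.
    · obtain ⟨x, hx, hmax⟩ := A.exists_max_image Finset.card hne
      have hmax' : ∀ y ∈ A, ¬ x ⊂ y := fun y hy hxy =>
        (Finset.card_lt_card hxy).not_ge (hmax y hy)
      have hS : unitSphere (inclusionGraph ι) A x = Finset.Ioo z x := by
        ext y
        rw [mem_unitSphere, Finset.mem_Ioo]
        constructor
        · rintro ⟨hy, h | h⟩
          · exact (hmax' y hy h).elim
          · exact ⟨hz y hy, h⟩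
        · rintro ⟨h₁, h₂⟩
          exact ⟨hA x hx y h₁ h₂.1, Or.inr h₂⟩
      have hss : Finset.Ioo z x ⊂ A := by
        refine (Finset.ssubset_iff_of_subset fun y hy => ?_).2 ⟨x, hx, Finset.right_notMem_Ioo⟩
        rw [Finset.mem_Ioo] at hy
        exact hA x hx y hy.1 hy.2.1
      have h₁ := ih _ hss (fun y hy => (Finset.mem_Ioo.1 hy).1) fun y hy w hw hwy =>
        Finset.mem_Ioo.2 ⟨hw, lt_of_le_of_lt hwy (Finset.mem_Ioo.1 hy).2⟩
      have h₂ := ih _ (Finset.erase_ssubset hx) (fun y hy => hz y (Finset.mem_of_mem_erase hy))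
        fun y hy w hw hwy => by
          have hyA := Finset.mem_of_mem_erase hy
          refine Finset.mem_erase.2 ⟨?_, hA y hyA w hw hwy⟩
          rintro rfl
          exact hmax' y hyA (lt_of_le_of_ne hwy (Finset.ne_of_mem_erase hy).symm)
      rw [sum_Ioo_neg_one_pow_card (hz x hx)] at h₁
      rw [cliqueSum_eq_erase_sub _ hx, hS, mul_sub, h₁, h₂, ← Finset.add_sum_erase A _ hx]
      ring

open scoped Classical in
/-- The sets in `G` that strictly contain `x`. -/
noncomputable def upperLink (G : Finset (Finset ι)) (x : Finset ι) : Finset (Finset ι) :=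
  G.filter fun y => x ⊂ y

-- The proper faces of `x` refine the boundary of a simplex, which is a sphere; the interval formula
-- with bottom `∅` gives the sign.
open scoped Classical in
theorem cliqueSum_lower_sq {G : Finset (Finset ι)} (hG : IsComplex G) {x : Finset ι}
    (hx : x ∈ G) : cliqueSum (inclusionGraph ι) (G.filter fun y => y ⊂ x) ^ 2 = 1 := by
  obtain ⟨hne, hdown⟩ := isComplex_iff.1 hG
  have hIoo : (G.filter fun y => y ⊂ x) = Finset.Ioo ∅ x := by
    ext y
    rw [Finset.mem_filter, Finset.mem_Ioo]
    refine and_congr_left fun hy => ?_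
    rw [Finset.empty_ssubset]
    exact ⟨hne y, hdown x hx y hy.1⟩
  have h := neg_one_pow_mul_cliqueSum (z := ∅) (A := Finset.Ioo ∅ x)
    (fun y hy => (Finset.mem_Ioo.1 hy).1)
    fun y hy w hw hwy => Finset.mem_Ioo.2 ⟨hw, lt_of_le_of_lt hwy (Finset.mem_Ioo.1 hy).2⟩
  rw [sum_Ioo_neg_one_pow_card (Finset.empty_ssubset.2 (hne x hx))] at h
  simp only [Finset.card_empty, pow_zero, one_mul] at h
  rw [hIoo, h]
  ring_nf
  rw [mul_comm, pow_mul]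
  simp

open scoped Classical in
theorem cliqueSum_unitSphere_sq {G : Finset (Finset ι)} (hG : IsComplex G) {x : Finset ι}
    (hx : x ∈ G) :
    cliqueSum (inclusionGraph ι) (unitSphere (inclusionGraph ι) G x) ^ 2
      = cliqueSum (inclusionGraph ι) (upperLink G x) ^ 2 := by
  have hS : unitSphere (inclusionGraph ι) G x = (G.filter fun y => y ⊂ x) ∪ upperLink G x := by
    ext y
    simp only [mem_unitSphere, inclusionGraph, Finset.mem_union, Finset.mem_filter, upperLink]
    tauto
  rw [hS, cliqueSum_union, mul_pow, cliqueSum_lower_sq hG hx, one_mul]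
  intro a ha b hb
  exact Or.inl ((Finset.mem_filter.1 ha).2.trans (Finset.mem_filter.1 hb).2)

theorem mem_boundary {d : ℕ} {G : Finset (Finset ι)} {x : Finset ι} :
    x ∈ boundary d G ↔
      x ∈ G ∧ IsBall (inclusionGraph ι) d (unitSphere (inclusionGraph ι) G x) := by
  simp [boundary]

theorem IsComplexWithBoundary.cliqueSum_upperLink_sq {d : ℕ} {G : Finset (Finset ι)}
    (hG : IsComplexWithBoundary d G) {x : Finset ι} (hx : x ∈ G) (hb : x ∉ boundary d G) :
    cliqueSum (inclusionGraph ι) (upperLink G x) ^ 2 = 1 := by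
  rw [← cliqueSum_unitSphere_sq hG.1 hx]
  obtain h | h := hG.2 x hx
  · rw [h.cliqueSum_eq, ← pow_mul, mul_comm, pow_mul]
    simp
  · exact (hb (mem_boundary.2 ⟨hx, h⟩)).elim

theorem IsComplexWithBoundary.cliqueSum_upperLink_eq_zero {d : ℕ} {G : Finset (Finset ι)}
    (hG : IsComplexWithBoundary d G) {x : Finset ι} (hx : x ∈ boundary d G) :
    cliqueSum (inclusionGraph ι) (upperLink G x) = 0 := by
  obtain ⟨hx, hb⟩ := mem_boundary.1 hx
  have h := cliqueSum_unitSphere_sq hG.1 hx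
  rw [hb.cliqueSum_eq_zero] at h
  exact pow_eq_zero_iff two_ne_zero |>.1 (h.symm.trans (by simp))

/-! ### The boundary is a complex -/

open scoped Classical in
theorem IsComplexWithBoundary.isComplex_boundary {d : ℕ} {G : Finset (Finset ι)}
    (hG : IsComplexWithBoundary d G) : IsComplex (boundary d G) := by
  obtain ⟨hne, hdown⟩ := isComplex_iff.1 hG.1
  refine isComplex_iff.2 ⟨fun x hx => hne x (mem_boundary.1 hx).1, fun x hx y hyx hy => ?_⟩
  obtain rfl | hlt := hyx.eq_or_ssubset
  · exact hx
  have hxG := (mem_boundary.1 hx).1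
  have hyG := hdown x hxG y hyx hy
  refine mem_boundary.2 ⟨hyG, (hG.2 y hyG).resolve_left fun hsph => ?_⟩
  have hxS : x ∈ unitSphere (inclusionGraph ι) G y := mem_unitSphere.2 ⟨hxG, Or.inl hlt⟩
  -- Inside `S(y)`, the unit sphere of `x` is still a join with the full upper link of `x`, whose
  -- clique sum vanishes.
  refine hsph.cliqueSum_unitSphere_ne_zero hxS ?_
  have hS : unitSphere (inclusionGraph ι) (unitSphere (inclusionGraph ι) G y) x
      = ((unitSphere (inclusionGraph ι) G y).filter fun w => w ⊂ x) ∪ upperLink G x := by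
    ext w
    simp only [mem_unitSphere, inclusionGraph, Finset.mem_union, Finset.mem_filter, upperLink]
    have : x ⊂ w → y ⊂ w := hlt.trans
    tauto
  rw [hS, cliqueSum_union, hG.cliqueSum_upperLink_eq_zero hx, mul_zero]
  intro a ha b hb
  exact Or.inl ((Finset.mem_filter.1 ha).2.trans (Finset.mem_filter.1 hb).2)

/-! ### The Wu characteristic through stars -/

open scoped Classical in
theorem sum_star_sign {G : Finset (Finset ι)} (hG : IsComplex G) {z : Finset ι} (hz : z ∈ G) :
    ∑ x ∈ G with z ⊆ x, sign x
      = -((-1) ^ z.card * cliqueSum (inclusionGraph ι) (upperLink G z)) := by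
  obtain ⟨hne, hdown⟩ := isComplex_iff.1 hG
  have hstar : (G.filter fun x => z ⊆ x) = insert z (upperLink G z) := by
    ext x
    simp only [Finset.mem_filter, Finset.mem_insert, upperLink]
    constructor
    · rintro ⟨hx, hzx⟩
      exact hzx.eq_or_ssubset.imp Eq.symm fun h => ⟨hx, h⟩
    · rintro (rfl | ⟨hx, h⟩)
      · exact ⟨hz, subset_rfl⟩
      · exact ⟨hx, h.1⟩
  have hzn : z ∉ upperLink G z := fun h => ssubset_irrefl z (Finset.mem_filter.1 h).2
  rw [neg_one_pow_mul_cliqueSum (A := upperLink G z) (fun x hx => (Finset.mem_filter.1 hx).2), hstar,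
    ← Finset.sum_insert (f := fun x : Finset ι => (-1 : ℤ) ^ x.card) hzn,
    ← Finset.sum_neg_distrib]
  · refine Finset.sum_congr rfl fun x hx => sign_eq_neg (hne x ?_)
    rw [← hstar] at hx
    exact (Finset.mem_filter.1 hx).1
  · intro x hx y hzy hyx
    exact Finset.mem_filter.2 ⟨hdown x (Finset.mem_filter.1 hx).1 y hyx
      ((hne z hz).mono hzy.1), hzy⟩

-- The common faces are the non-empty subsets of `x ∩ y`, a simplex of Euler characteristic 1 or
-- nothing at all.
open scoped Classical in
theorem sum_sign_common_faces {G : Finset (Finset ι)} (hG : IsComplex G) {x : Finset ι}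
    (hx : x ∈ G) (y : Finset ι) :
    ∑ z ∈ G with z ⊆ x ∧ z ⊆ y, sign z = if (x ∩ y).Nonempty then 1 else 0 := by
  obtain ⟨hne, hdown⟩ := isComplex_iff.1 hG
  have hset : (G.filter fun z => z ⊆ x ∧ z ⊆ y) = (x ∩ y).powerset.erase ∅ := by
    ext z
    simp only [Finset.mem_filter, Finset.mem_erase, Finset.mem_powerset, Finset.subset_inter_iff]
    refine and_congr_left fun hz => ?_
    rw [← Finset.nonempty_iff_ne_empty]
    exact ⟨hne z, hdown x hx z hz.1⟩
  have h := Finset.add_sum_erase (x ∩ y).powerset (fun z : Finset ι => (-1 : ℤ) ^ z.card)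
    (Finset.empty_mem_powerset _)
  rw [Finset.sum_powerset_neg_one_pow_card, Finset.card_empty, pow_zero] at h
  rw [hset, Finset.sum_congr rfl fun z hz => sign_eq_neg
    (Finset.nonempty_iff_ne_empty.2 (Finset.ne_of_mem_erase hz)), Finset.sum_neg_distrib]
  by_cases hxy : x ∩ y = ∅
  · rw [if_pos hxy] at h
    rw [if_neg (by simp [hxy])]
    linarith
  · rw [if_neg hxy] at h
    rw [if_pos (Finset.nonempty_iff_ne_empty.2 hxy)]
    linarith

open scoped Classical in
/-- The Wu characteristic as a sum over the common faces of pairs of simplices. -/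
theorem wuChar_eq_sum_star {G : Finset (Finset ι)} (hG : IsComplex G) :
    wuChar G = ∑ z ∈ G, sign z * (∑ x ∈ G with z ⊆ x, sign x) ^ 2 := by
  calc wuChar G
      = ∑ x ∈ G, ∑ y ∈ G, ∑ z ∈ G,
          if z ⊆ x ∧ z ⊆ y then sign z * (sign x * sign y) else 0 := by
        refine Finset.sum_congr rfl fun x hx => ?_
        rw [Finset.sum_filter]
        refine Finset.sum_congr rfl fun y _ => ?_
        rw [← Finset.sum_filter, ← Finset.sum_mul, sum_sign_common_faces hG hx y, ite_mul,
          one_mul, zero_mul]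
    _ = ∑ z ∈ G, ∑ x ∈ G, ∑ y ∈ G,
          if z ⊆ x ∧ z ⊆ y then sign z * (sign x * sign y) else 0 := by
        rw [Finset.sum_comm (s := G) (t := G) (f := fun z x => ∑ y ∈ G,
          if z ⊆ x ∧ z ⊆ y then sign z * (sign x * sign y) else 0)]
        exact Finset.sum_congr rfl fun x _ => Finset.sum_comm
    _ = _ := by
        refine Finset.sum_congr rfl fun z _ => ?_
        rw [sq, Finset.sum_filter, Finset.sum_mul_sum, Finset.mul_sum]
        refine Finset.sum_congr rfl fun x _ => ?_
        rw [Finset.mul_sum]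
        refine Finset.sum_congr rfl fun y _ => ?_
        by_cases h₁ : z ⊆ x <;> by_cases h₂ : z ⊆ y <;> simp [h₁, h₂]

theorem IsComplexWithBoundary.wuChar_eq {d : ℕ} {G : Finset (Finset ι)}
    (hG : IsComplexWithBoundary d G) : wuChar G = eulerChar G - eulerChar (boundary d G) := by
  classical
  have hsub : boundary d G ⊆ G := Finset.filter_subset _ _
  rw [wuChar_eq_sum_star hG.1, eulerChar, eulerChar, ← Finset.sum_sdiff hsub,
    ← Finset.sum_sdiff (f := fun x => sign x) hsub, add_sub_cancel_right]
  have hstar : ∀ z ∈ G, (∑ x ∈ G with z ⊆ x, sign x) ^ 2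
      = cliqueSum (inclusionGraph ι) (upperLink G z) ^ 2 := fun z hz => by
    rw [sum_star_sign hG.1 hz, neg_sq, mul_pow, ← pow_mul, mul_comm z.card, pow_mul]
    simp
  rw [Finset.sum_eq_zero (s := boundary d G), add_zero]
  · refine Finset.sum_congr rfl fun z hz => ?_
    obtain ⟨hzG, hzb⟩ := Finset.mem_sdiff.1 hz
    rw [hstar z hzG, hG.cliqueSum_upperLink_sq hzG hzb, mul_one]
  · intro z hz
    rw [hstar z (hsub hz), hG.cliqueSum_upperLink_eq_zero hz]
    simp

end Complexes

end DiscreteManifold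

theorem mainTheorem10 {ι : Type*} (d : ℕ) (G : Finset (Finset ι))
    (hG : DiscreteManifold.IsComplexWithBoundary d G) :
    DiscreteManifold.IsComplex (DiscreteManifold.boundary d G) ∧
    DiscreteManifold.wuChar G =
      DiscreteManifold.eulerChar G
        - DiscreteManifold.eulerChar (DiscreteManifold.boundary d G) ∧
    DiscreteManifold.internalEnergy G =
      DiscreteManifold.eulerChar (DiscreteManifold.boundary d G) := by
  refine ⟨hG.isComplex_boundary, hG.wuChar_eq, ?_⟩
  rw [DiscreteManifold.internalEnergy, hG.wuChar_eq, sub_sub_cancel]
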